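/- Definitions. Let $Y$ be an inhabited set with an inequality $\neq$ (an irreflexive, symmetric relation) and a symmetric relation $\bowtie$ between subsets of $Y$. For $S\subset Y$ put $\mathord{\sim}S=\{y\in Y:\forall s\in S\;(y\neq s)\}$ and $-S=\{y\in Y:\{y\}\bowtie S\}$. Then $Y$ is an *apartness space* if for all subsets: (B1) $Y\bowtie\varnothing$; (B2) $-A\subset\mathord{\sim}A$; (B3) $(A_1\cup A_2)\bowtie(B_1\cup B_2)$ if and only if $A_i\bowtie B_j$ for all $i,j\in\{1,2\}$; (B4) $-A\subset\mathord{\sim}B$ implies $-A\subset -B$; (B5) if $x\in -A$, then there is $S\subset Y$ with $x\in -S$ and $Y=-A\cup S$. The sets $-S$ form a base of the *apartness topology*, to which "dense" and "neighbourhood" refer. A subset $X\subset Y$ carries the induced apartness: $A\bowtie_X B$ if and only if $A\bowtie B$ in $Y$. A (Hausdorff) uniform space $(X,\mathcal U)$ has the inequality $x\neq y\Leftrightarrow\exists U\in\mathcal U\;((x,y)\notin U)$ and the apartness $S\bowtie T\Leftrightarrow\exists U\in\mathcal U\;(S\times T\subset\mathord{\sim}U)$. A *uniform subspace* of an apartness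 space $Y$ is a subset $X$ with a Hausdorff uniform structure whose apartness coincides with the one induced on $X$ by $Y$. A map $f$ between apartness spaces is *strongly continuous* if $f(A)\bowtie f(B)$ implies $A\bowtie B$ for all subsets $A,B$ of its domain. An apartness space $Y$ is - *first countable* if every point has a countable base of neighbourhoods in the apartness topology; - *weakly symmetrically separated* if, whenever $S\bowtie T$, for each $x\in Y$ there is $U\subset Y$ such that $x\in -U$ and $S\cap -U$, $T\cap -U$ are not both inhabited; - *precompact* if there is a strongly continuous map from a dense subset of the Cantor space $2^{\mathbf N}$ (with the apartness of its product uniform structure) onto a dense subset of $Y$. It has the *Efremovič property* if $S\bowtie T$ implies that there is $E\subset Y$ with $S\bowtie (Y\setminus E)$ and $E\bowtie T$. Proposition. Let $Y$ be a first-countable, weakly symmetrically separated, precompact apartness space with the Efremovič property. Let $X$ be a dense uniform subspace of $Y$, and let $\widehat X$ be a complete (Hausdorff) uniform space containing $X$, with its uniform structure, as a dense subspace. Then the uniform space $X$ is totally bounded: for each entourage $U$ of $X$ there are finitely many points $x_1,\dots,x_n\in X$ such that $X=\bigcup_{i=1}^n\{y\in X:(x_i,y)\in U\}$. -/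

import Mathlib

/-- The complement `∼S` of `S` for an inequality relation `ne`:
the points that are unequal to every point of `S`. -/
def ineqCompl {X : Type*} (ne : X → X → Prop) (S : Set X) : Set X :=
  {x | ∀ s ∈ S, ne x s}

/-- The apartness complement `-S` of `S` for a relation `apart` between subsets. -/
def apartCompl {X : Type*} (apart : Set X → Set X → Prop) (S : Set X) : Set X :=
  {x | apart {x} S}

/-- A (symmetric) pre-apartness on `X`: an inequality relation `ne` (irreflexive and symmetric)
and a relation `apart` between subsets of `X` satisfying B1, B2, B3, B4 and symmetry. -/
structure PreApartness (X : Type*) where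
  ne : X → X → Prop
  ne_irrefl : ∀ x, ¬ ne x x
  ne_symm : ∀ x y, ne x y → ne y x
  apart : Set X → Set X → Prop
  symm : ∀ A B, apart A B → apart B A
  b1 : apart Set.univ ∅
  b2 : ∀ A, apartCompl apart A ⊆ ineqCompl ne A
  b3 : ∀ A₁ A₂ B₁ B₂, apart (A₁ ∪ A₂) (B₁ ∪ B₂) ↔
    (apart A₁ B₁ ∧ apart A₁ B₂ ∧ apart A₂ B₁ ∧ apart A₂ B₂)
  b4 : ∀ A B, apartCompl apart A ⊆ ineqCompl ne B → apartCompl apart A ⊆ apartCompl apart B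

/-- An apartness on `X`: a pre-apartness that also satisfies B5. -/
structure Apartness (X : Type*) extends PreApartness X where
  b5 : ∀ (A : Set X) (x : X), x ∈ apartCompl apart A →
    ∃ S : Set X, x ∈ apartCompl apart S ∧ Set.univ = apartCompl apart A ∪ S

namespace PreApartness

variable {X Y : Type*}

theorem mono (P : PreApartness X) {A A' B B' : Set X} (hA : A' ⊆ A) (hB : B' ⊆ B)
    (h : P.apart A B) : P.apart A' B' := by
  rw [← Set.union_eq_self_of_subset_left hA, ← Set.union_eq_self_of_subset_left hB] at h
  exact ((P.b3 _ _ _ _).1 h).1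

/-- The apartness complement `-S`. -/
def compl (P : PreApartness X) (S : Set X) : Set X := apartCompl P.apart S

theorem compl_union (P : PreApartness X) (S T : Set X) :
    P.compl (S ∪ T) = P.compl S ∩ P.compl T := by
  ext x
  have h := P.b3 {x} {x} S T
  rw [Set.union_self] at h
  change P.apart {x} (S ∪ T) ↔ P.apart {x} S ∧ P.apart {x} T
  tauto

/-- The apartness topology: the apartness complements form a base of open sets. -/
abbrev topology (P : PreApartness X) : TopologicalSpace X where
  IsOpen U := ∀ x ∈ U, ∃ S, x ∈ P.compl S ∧ P.compl S ⊆ U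
  isOpen_univ := fun _ _ => ⟨∅, P.mono (Set.subset_univ _) le_rfl P.b1, Set.subset_univ _⟩
  isOpen_inter := by
    rintro U V hU hV x ⟨hxU, hxV⟩
    obtain ⟨S, hS, hSU⟩ := hU x hxU
    obtain ⟨T, hT, hTV⟩ := hV x hxV
    refine ⟨S ∪ T, ?_, ?_⟩
    · rw [compl_union]; exact ⟨hS, hT⟩
    · rw [compl_union]; exact Set.inter_subset_inter hSU hTV
  isOpen_sUnion := by
    rintro C hC x ⟨U, hU, hx⟩
    obtain ⟨S, hS, hSU⟩ := hC U hU x hx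
    exact ⟨S, hS, hSU.trans (Set.subset_sUnion_of_mem hU)⟩

/-- Density with respect to the apartness topology. -/
def IsDense (P : PreApartness X) (S : Set X) : Prop := @Dense X P.topology S

/-- Every point has a countable base of neighbourhoods in the apartness topology. -/
def FirstCountable (P : PreApartness X) : Prop := @FirstCountableTopology X P.topology

/-- Weak symmetric separatedness, where `S - U` means `S ∩ -U`. -/
def WeaklySymmetricallySeparated (P : PreApartness X) : Prop :=
  ∀ S T : Set X, P.apart S T → ∀ x : X, ∃ U : Set X, x ∈ P.compl U ∧
    ¬ ((S ∩ P.compl U).Nonempty ∧ (T ∩ P.compl U).Nonempty)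

/-- The Efremovič property. -/
def Efremovic (P : PreApartness X) : Prop :=
  ∀ S T : Set X, P.apart S T → ∃ E : Set X, P.apart S Eᶜ ∧ P.apart E T

/-- Strong continuity of a mapping between pre-apartness spaces. -/
def StronglyContinuous (P : PreApartness X) (Q : PreApartness Y) (f : X → Y) : Prop :=
  ∀ A B : Set X, Q.apart (f '' A) (f '' B) → P.apart A B

end PreApartness

namespace Apartness

variable {Y : Type*}

/-- The apartness induced on a subset `X` of an apartness space. -/
def subspace (P : Apartness Y) (X : Set Y) : Apartness X where
  ne x y := P.ne x y
  ne_irrefl x := P.ne_irrefl x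
  ne_symm x y := P.ne_symm x y
  apart A B := P.apart (Subtype.val '' A) (Subtype.val '' B)
  symm A B := P.symm _ _
  b1 := by
    rw [Set.image_empty]
    exact P.mono (Set.subset_univ _) le_rfl P.b1
  b2 := by
    intro A x hx s hs
    rw [apartCompl, Set.mem_ofPred_eq, Set.image_singleton] at hx
    exact P.b2 _ hx _ (Set.mem_image_of_mem _ hs)
  b3 := by
    intro A₁ A₂ B₁ B₂
    rw [Set.image_union, Set.image_union]
    exact P.b3 _ _ _ _
  b4 := by
    intro A B hAB x hx
    rw [apartCompl, Set.mem_ofPred_eq, Set.image_singleton] at hx ⊢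
    obtain ⟨S, hS, hU⟩ := P.b5 _ _ hx
    refine P.mono le_rfl ?_ hS
    rintro _ ⟨b, hb, rfl⟩
    have hbU : (b : Y) ∈ apartCompl P.apart (Subtype.val '' A) ∪ S := hU ▸ Set.mem_univ _
    rcases hbU with h | h
    · refine absurd (hAB (a := b) ?_ b hb) (P.ne_irrefl b)
      rw [apartCompl, Set.mem_ofPred_eq, Set.image_singleton]
      exact h
    · exact h
  b5 := by
    intro A x hx
    rw [apartCompl, Set.mem_ofPred_eq, Set.image_singleton] at hx
    obtain ⟨S, hS, hU⟩ := P.b5 _ _ hx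
    refine ⟨Subtype.val ⁻¹' S, ?_, ?_⟩
    · rw [apartCompl, Set.mem_ofPred_eq, Set.image_singleton]
      exact P.mono le_rfl (Set.image_preimage_subset _ _) hS
    · refine (Set.eq_univ_of_forall fun y => ?_).symm
      have hyU : (y : Y) ∈ apartCompl P.apart (Subtype.val '' A) ∪ S := hU ▸ Set.mem_univ _
      rcases hyU with h | h
      · left
        rw [apartCompl, Set.mem_ofPred_eq, Set.image_singleton]
        exact h
      · exact Or.inr h

end Apartness

section Uniform

open Uniformity

/-- The inequality of a uniform space: some entourage does not contain `(x, y)`. -/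
def uniformNe (X : Type*) [UniformSpace X] (x y : X) : Prop := ∃ U ∈ 𝓤 X, (x, y) ∉ U

/-- The corresponding inequality on the product `X × X`. -/
def uniformProdNe (X : Type*) [UniformSpace X] (p q : X × X) : Prop :=
  uniformNe X p.1 q.1 ∨ uniformNe X p.2 q.2

/-- The apartness relation of a uniform space: `S × T ⊆ ∼U` for some entourage `U`. -/
def uniformApart (X : Type*) [UniformSpace X] (S T : Set X) : Prop :=
  ∃ U ∈ 𝓤 X, S ×ˢ T ⊆ ineqCompl (uniformProdNe X) U

theorem uniformNe_iff {X : Type*} [UniformSpace X] [T0Space X] {x y : X} :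
    uniformNe X x y ↔ x ≠ y := by
  rw [Ne, ← inseparable_iff_eq, inseparable_iff_ker_uniformity, Filter.mem_ker]
  simp [uniformNe]

theorem uniformApart_iff {X : Type*} [UniformSpace X] [T0Space X] {S T : Set X} :
    uniformApart X S T ↔ ∃ U ∈ 𝓤 X, ∀ s ∈ S, ∀ t ∈ T, (s, t) ∉ U := by
  refine exists_congr fun U => and_congr_right fun _ => ?_
  constructor
  · intro h s hs t ht hU
    have := h (Set.mk_mem_prod hs ht) _ hU
    simp [uniformProdNe, uniformNe_iff] at this
  · rintro h ⟨s, t⟩ ⟨hs, ht⟩ ⟨a, b⟩ hab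
    simp only [uniformProdNe, uniformNe_iff]
    by_contra! hc
    obtain ⟨h1, h2⟩ := hc
    subst h1 h2
    exact h _ hs _ ht hab

theorem uniformApart_b5 {X : Type*} [UniformSpace X] [T0Space X] (A : Set X) (x : X)
    (hx : x ∈ apartCompl (uniformApart X) A) :
    ∃ S : Set X, x ∈ apartCompl (uniformApart X) S ∧
      Set.univ = apartCompl (uniformApart X) A ∪ S := by
  obtain ⟨U, hU, h⟩ := uniformApart_iff.1 hx
  obtain ⟨V, hV, hVU⟩ := comp_mem_uniformity_sets hU
  refine ⟨{y | (x, y) ∉ V}, uniformApart_iff.2 ⟨V, hV, ?_⟩, ?_⟩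
  · rintro s rfl t ht
    exact ht
  · refine (Set.eq_univ_of_forall fun y => ?_).symm
    by_cases hy : (x, y) ∈ V
    · refine Or.inl (uniformApart_iff.2 ⟨V, hV, ?_⟩)
      rintro s rfl a ha hsa
      exact h x rfl a ha (hVU ⟨s, hy, hsa⟩)
    · exact Or.inr hy

/-- The apartness structure of a (Hausdorff) uniform space. -/
def uniformApartness (X : Type*) [UniformSpace X] [T0Space X] : Apartness X where
  ne := uniformNe X
  ne_irrefl x := by simp [uniformNe_iff]
  ne_symm x y := by simpa [uniformNe_iff] using fun h => Ne.symm h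
  apart := uniformApart X
  symm A B h := by
    obtain ⟨U, hU, h⟩ := uniformApart_iff.1 h
    exact uniformApart_iff.2 ⟨_, UniformSpace.symm hU, fun s hs t ht hst => h t ht s hs hst⟩
  b1 := uniformApart_iff.2 ⟨Set.univ, Filter.univ_mem, by simp⟩
  b2 A x hx a ha := by
    obtain ⟨U, hU, h⟩ := uniformApart_iff.1 hx
    exact ⟨U, hU, h x rfl a ha⟩
  b3 A₁ A₂ B₁ B₂ := by
    simp only [uniformApart_iff]
    constructor
    · rintro ⟨U, hU, h⟩
      exact ⟨⟨U, hU, fun s hs t ht => h s (.inl hs) t (.inl ht)⟩,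
        ⟨U, hU, fun s hs t ht => h s (.inl hs) t (.inr ht)⟩,
        ⟨U, hU, fun s hs t ht => h s (.inr hs) t (.inl ht)⟩,
        ⟨U, hU, fun s hs t ht => h s (.inr hs) t (.inr ht)⟩⟩
    · rintro ⟨⟨U, hU, h⟩, ⟨U', hU', h'⟩, ⟨V, hV, k⟩, ⟨V', hV', k'⟩⟩
      refine ⟨(U ∩ U') ∩ (V ∩ V'), Filter.inter_mem (Filter.inter_mem hU hU')
        (Filter.inter_mem hV hV'), ?_⟩
      rintro s (hs | hs) t (ht | ht) ⟨⟨h1, h2⟩, h3, h4⟩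
      · exact h s hs t ht h1
      · exact h' s hs t ht h2
      · exact k s hs t ht h3
      · exact k' s hs t ht h4
  b4 A B hAB x hx := by
    obtain ⟨S, hS, hU⟩ := uniformApart_b5 A x hx
    obtain ⟨U, hU', h⟩ := uniformApart_iff.1 hS
    refine uniformApart_iff.2 ⟨U, hU', fun s hs b hb => h s hs b ?_⟩
    have hbU : b ∈ apartCompl (uniformApart X) A ∪ S := hU ▸ Set.mem_univ _
    rcases hbU with hb' | hb'
    · exact absurd rfl (uniformNe_iff.1 (hAB hb' b hb))
    · exact hb'
  b5 := uniformApart_b5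

/-- `X`, with the uniform structure `𝒰`, is a uniform subspace of the apartness space `Y`: the
apartness induced on `X` by that of `Y` coincides with the apartness induced by `𝒰`. -/
def Apartness.IsUniformSubspace {Y : Type*} (P : Apartness Y) (X : Set Y)
    [UniformSpace X] [T0Space X] : Prop :=
  ∀ S T : Set X, (P.subspace X).apart S T ↔ (uniformApartness X).apart S T

/-- Precompactness: some strongly continuous mapping takes a dense subset of Cantor space `2^ℕ`
onto a dense subset of the space. -/
def Apartness.Precompact {Y : Type*} (P : Apartness Y) : Prop :=
  ∃ D : Set (ℕ → Bool), Dense D ∧ ∃ h : D → Y,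
    PreApartness.StronglyContinuous ((uniformApartness (ℕ → Bool)).subspace D).toPreApartness
      P.toPreApartness h ∧ P.IsDense (Set.range h)

end Uniform

/-!
Classically, an apartness with the Efremovič property is (the negation of) a proximity, and strong
continuity is proximal continuity. The proof is by contradiction.

If `X` is not totally bounded, some entourage `U` has a `U`-separated sequence `x n` in `X`. Any two
subsequences of `x` with disjoint index sets are apart, and this persists when every `x n` is
replaced by any point of a small neighbourhood `W n` of `x n` in `Y`: in `X` this holds by the
triangle inequality for entourages, and in `Y` because the Efremovič property lets apartness pass
to closures (`PreApartness.Efremovic.apart_closure`), while `W n` lies in the closure of its trace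
on the dense set `X`. As the image of the precompactness map `h` is dense, one may choose points
`d n` in the Cantor space with `h (d n) ∈ W n`. By strong continuity, subsequences of `d` with
disjoint index sets are then apart as well. This is impossible, for `d` has a convergent
subsequence, whose terms of even and of odd rank are not apart
(`exists_disjoint_not_uniformApart`).
-/

open Uniformity Topology

namespace PreApartness

variable {X : Type*} (P : PreApartness X)

theorem not_apart_of_mem {A B : Set X} {x : X} (hA : x ∈ A) (hB : x ∈ B) : ¬ P.apart A B :=
  fun h => P.ne_irrefl x <| P.b2 B
    (P.mono (Set.singleton_subset_iff.2 hA) le_rfl h : P.apart {x} B) x hB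

theorem isOpen_compl (S : Set X) : @IsOpen X P.topology (P.compl S) :=
  fun _ hx => ⟨S, hx, le_rfl⟩

variable {P}

theorem Efremovic.apart_closure_left (hP : P.Efremovic) {A B : Set X} (h : P.apart A B) :
    P.apart (@closure X P.topology A) B := by
  let _ := P.topology
  obtain ⟨E, hAE, hEB⟩ := hP A B h
  refine P.mono (fun y hy => ?_) le_rfl hEB
  by_contra hyE
  -- Outside `E` the point `y` is apart from `A`, so `P.compl A` is an open set around `y` which
  -- does not meet `A`.
  have hyA : y ∈ P.compl A :=
    P.symm _ _ (P.mono le_rfl (Set.singleton_subset_iff.2 hyE) hAE)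
  obtain ⟨a, ha, haA⟩ := mem_closure_iff.1 hy _ (P.isOpen_compl A) hyA
  exact P.not_apart_of_mem (Set.mem_singleton a) haA ha

theorem Efremovic.apart_closure (hP : P.Efremovic) {A B : Set X} (h : P.apart A B) :
    P.apart (@closure X P.topology A) (@closure X P.topology B) :=
  P.symm _ _ (hP.apart_closure_left (P.symm _ _ (hP.apart_closure_left h)))

end PreApartness

theorem exists_separated_seq_of_not_totallyBounded {X : Type*} [UniformSpace X]
    (h : ¬ TotallyBounded (Set.univ : Set X)) :
    ∃ U ∈ 𝓤 X, ∃ x : ℕ → X, ∀ m n, m ≠ n → (x m, x n) ∉ U := by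
  simp only [totallyBounded_iff_subset, not_forall] at h
  obtain ⟨V, hV, hfin⟩ := h
  have hstep : ∀ t : Set X, t.Finite → ∃ y, ∀ z ∈ t, (y, z) ∉ V := by
    intro t ht
    by_contra! hc
    exact hfin ⟨t, Set.subset_univ _, ht, fun y _ => by simpa using hc y⟩
  obtain ⟨x, hx⟩ := Set.seq_of_forall_finite_exists hstep
  refine ⟨V ∩ Prod.swap ⁻¹' V, Filter.inter_mem hV (symm_le_uniformity hV), x, ?_⟩
  rintro m n hmn ⟨h1, h2⟩
  rcases lt_or_gt_of_ne hmn with hlt | hlt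
  · exact hx n _ ⟨m, hlt, rfl⟩ h2
  · exact hx m _ ⟨n, hlt, rfl⟩ h1

/-- In a first-countable compact Hausdorff uniform space no sequence is such that all pairs of subsequences with disjoint
index sets are apart. -/
theorem exists_disjoint_not_uniformApart {K : Type*} [UniformSpace K] [T0Space K] [CompactSpace K]
    [FirstCountableTopology K] (d : ℕ → K) :
    ∃ A B : Set ℕ, Disjoint A B ∧ ¬ uniformApart K (d '' A) (d '' B) := by
  obtain ⟨a, φ, hφ, ha⟩ := CompactSpace.tendsto_subseq d
  refine ⟨Set.range fun k => φ (2 * k), Set.range fun k => φ (2 * k + 1), ?_, ?_⟩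
  · rw [Set.disjoint_left]
    rintro _ ⟨k, rfl⟩ ⟨l, hl⟩
    have := hφ.injective hl
    omega
  · rw [uniformApart_iff]
    rintro ⟨U, hU, h⟩
    have hev : Filter.Tendsto (fun k : ℕ => 2 * k) Filter.atTop Filter.atTop :=
      Filter.tendsto_atTop_mono (fun k => by rw [id]; omega) Filter.tendsto_id
    have hodd : Filter.Tendsto (fun k : ℕ => 2 * k + 1) Filter.atTop Filter.atTop :=
      Filter.tendsto_atTop_mono (fun k => by rw [id]; omega) Filter.tendsto_id
    have hpair := ((ha.comp hev).prodMk_nhds (ha.comp hodd)).eventually_mem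
      (nhds_le_uniformity a hU)
    obtain ⟨k, hk⟩ := hpair.exists
    exact h _ ⟨_, ⟨k, rfl⟩, rfl⟩ _ ⟨_, ⟨k, rfl⟩, rfl⟩ hk

/-- A separated sequence in a dense uniform subspace has neighbourhoods in the ambient apartness
space whose unions over disjoint index sets are apart. -/
theorem Apartness.IsUniformSubspace.exists_isOpen_apart {Y : Type*} {P : Apartness Y}
    (hef : P.Efremovic) {X : Set Y} [UniformSpace X] [T0Space X] (hX : P.IsUniformSubspace X)
    (hXdense : P.IsDense X) {U : Set (X × X)} (hU : U ∈ 𝓤 X) {x : ℕ → X}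
    (hx : ∀ m n, m ≠ n → (x m, x n) ∉ U) :
    ∃ W : ℕ → Set Y, (∀ n, @IsOpen Y P.topology (W n)) ∧ (∀ n, (x n : Y) ∈ W n) ∧
      ∀ A B : Set ℕ, Disjoint A B → P.apart (⋃ n ∈ A, W n) (⋃ n ∈ B, W n) := by
  let _ := P.topology
  obtain ⟨V, hV, hVsymm, hVU⟩ := comp_comp_symm_mem_uniformity_sets hU
  let T : ℕ → Set X := fun n => {z | (x n, z) ∈ V}
  refine ⟨fun n => P.compl (Subtype.val '' (T n)ᶜ), fun n => P.isOpen_compl _, fun n => ?_,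
    fun A B hAB => ?_⟩
  · have : (P.subspace X).apart {x n} (T n)ᶜ := by
      refine (hX _ _).2 (uniformApart_iff.2 ⟨V, hV, ?_⟩)
      rintro _ rfl t ht
      exact ht
    change P.apart (Subtype.val '' {x n}) (Subtype.val '' (T n)ᶜ) at this
    rwa [Set.image_singleton] at this
  · have hTT : P.apart (Subtype.val '' ⋃ n ∈ A, T n) (Subtype.val '' ⋃ n ∈ B, T n) := by
      refine (hX _ _).2 (uniformApart_iff.2 ⟨V, hV, ?_⟩)
      intro s hs t ht hst
      simp only [Set.mem_iUnion] at hs ht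
      obtain ⟨m, hm, hms⟩ := hs
      obtain ⟨n, hn, hnt⟩ := ht
      refine hx m n (fun h => Set.disjoint_left.1 hAB hm (h ▸ hn)) (hVU ?_)
      exact ⟨t, ⟨s, hms, hst⟩, hVsymm.symm _ _ hnt⟩
    have hsub : ∀ C : Set ℕ, (⋃ n ∈ C, P.compl (Subtype.val '' (T n)ᶜ)) ⊆
        closure (Subtype.val '' ⋃ n ∈ C, T n) := by
      refine fun C => Set.iUnion₂_subset fun n hn => ?_
      refine (hXdense.open_subset_closure_inter (P.isOpen_compl _)).trans (closure_mono ?_)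
      rintro y ⟨hyW, hyX⟩
      refine ⟨⟨y, hyX⟩, Set.mem_biUnion hn ?_, rfl⟩
      by_contra hyT
      exact P.not_apart_of_mem (Set.mem_singleton y)
        (Set.mem_image_of_mem Subtype.val (show (⟨y, hyX⟩ : X) ∈ (T n)ᶜ from hyT)) hyW
    exact P.mono (hsub A) (hsub B) (hef.apart_closure hTT)

theorem proposition2p9 {Y : Type*} (P : Apartness Y)
    (hfc : P.FirstCountable)
    (hwss : P.WeaklySymmetricallySeparated)
    (hpc : P.Precompact)
    (hef : P.Efremovic)
    (X : Set Y) [UniformSpace X] [T0Space X]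
    (hX : P.IsUniformSubspace X)
    (hXdense : P.IsDense X)
    {Z : Type*} [UniformSpace Z] [T0Space Z] [CompleteSpace Z]
    (i : X → Z) (hi : IsUniformEmbedding i) (hidense : DenseRange i) :
    TotallyBounded (Set.univ : Set X) := by
  by_contra hnot
  obtain ⟨U, hU, x, hx⟩ := exists_separated_seq_of_not_totallyBounded hnot
  obtain ⟨W, hWo, hxW, hW⟩ := hX.exists_isOpen_apart hef hXdense hU hx
  obtain ⟨D, -, h, hsc, hdense⟩ := hpc
  have hd : ∀ n, ∃ d : D, h d ∈ W n := fun n => by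
    let _ := P.topology
    obtain ⟨_, hy, d, rfl⟩ := hdense.inter_open_nonempty (W n) (hWo n) ⟨_, hxW n⟩
    exact ⟨d, hy⟩
  choose d hd using hd
  obtain ⟨A, B, hAB, hnA⟩ := exists_disjoint_not_uniformApart fun n => (d n : ℕ → Bool)
  have hsub : ∀ C : Set ℕ, h '' (d '' C) ⊆ ⋃ n ∈ C, W n := by
    rintro C _ ⟨_, ⟨n, hn, rfl⟩, rfl⟩
    exact Set.mem_biUnion hn (hd n)
  have happ : uniformApart (ℕ → Bool) (Subtype.val '' (d '' A)) (Subtype.val '' (d '' B)) :=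
    hsc _ _ (P.mono (hsub A) (hsub B) (hW A B hAB))
  rw [Set.image_image, Set.image_image] at happ
  exact hnA happ
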